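/- Let $m\ge 1$, let $\Delta^m=\{t\in\mathbb{R}_{\ge 0}^m:\sum_y t_y=1\}$, and let $X$ (with values in a measurable space $\mathcal{X}$) and $Y$ (with values in $\{1,\dots,m\}$) be random variables on a probability space. Let $g\colon\mathcal{X}\to\Delta^m$ be measurable, put $G:=g(X)$ with law $\mu_G$, and let $\Delta:=\big(\mathbb{P}[Y=y\mid G]\big)_{y=1}^m-G$. Let $k\colon\Delta^m\times\Delta^m\to\mathbb{R}^{m\times m}$ be a matrix-valued kernel, i.e. $k(s,t)=k(t,s)^{\mathsf T}$ for all $s,t$ and $\sum_{i,j=1}^n u_i^{\mathsf T}k(t_i,t_j)u_j\ge 0$ for all $n$, $t_1,\dots,t_n\in\Delta^m$, $u_1,\dots,u_n\in\mathbb{R}^m$. Let $\mathcal{H}$ be the reproducing kernel Hilbert space of functions $\Delta^m\to\mathbb{R}^m$ with kernel $k$, and let $$\mathrm{KCE}:=\sup_{f\in\mathcal{H},\,\|f\|_{\mathcal H}\le 1}\mathbb{E}\big[\langle\Delta,f(G)\rangle\big],\qquad \mathrm{SKCE}:=\mathrm{KCE}^2 .$$ With $e_y$ the $y$th unit vector,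 put $\delta(x,y):=e_y-g(x)$ and $$h\big((x,y),(x',y')\big):=\big\langle\delta(x,y),\,k(g(x),g(x'))\,\delta(x',y')\big\rangle .$$ Let $(X_1,Y_1),(X_2,Y_2),\dots$ be i.i.d. copies of $(X,Y)$ and, for $n\ge 2$, let $$\widehat{\mathrm{SKCE}}_{uq}:=\frac{1}{n(n-1)}\sum_{\substack{i,j=1\\ i\ne j}}^n h\big((X_i,Y_i),(X_j,Y_j)\big).$$ **Theorem.** Assume that $s\mapsto k(s,t)u$ is measurable for all $t\in\Delta^m$ and $u\in\mathbb{R}^m$, and that $\|k\|_{\mu_G,1}:=\int_{\Delta^m}\|k(t,t)\|^{1/2}\,\mu_G(\mathrm{d}t)<\infty$. Let $Z,Z',Z''$ be independent copies of $(X,Y)$, and assume that $h(Z,Z')$ is a random variable (that is, $h$ is measurable up to null sets of the law of $(Z,Z')$) with finite variance. Then the functions in the unit ball of $\mathcal{H}$ are $\mu_G$-integrable and $\mathrm{KCE}$ is finite, and, as $n\to\infty$, $$\sqrt n\,\big(\widehat{\mathrm{SKCE}}_{uq}-\mathrm{SKCE}\big)\xrightarrow{d}\mathcal{N}(0,4\zeta_1),\qquad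 \zeta_1:=\mathbb{E}\big[h(Z,Z')\,h(Z,Z'')\big]-\mathrm{SKCE}^2\ \ge 0 ,$$ where $\mathcal{N}(0,0)$ denotes the point mass at $0$. -/

import Mathlib

open MeasureTheory ProbabilityTheory Filter
open scoped Topology RealInnerProductSpace ENNReal

noncomputable section

namespace CalibrationError

/-- The probability simplex `Δ^m` (with the Borel `σ`-algebra inherited from `ℝ^m`). -/
abbrev Simplex (m : ℕ) : Type := ↥(stdSimplex ℝ (Fin m))

/-- `ℝ^m` with its Euclidean inner product. -/
abbrev Vec (m : ℕ) : Type := EuclideanSpace ℝ (Fin m)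

/-- A point of the simplex viewed as a vector of `ℝ^m`. -/
def Simplex.toVec {m : ℕ} (t : Simplex m) : Vec m :=
  WithLp.toLp 2 (fun y => (t : Fin m → ℝ) y)

/-- Matrix-valued kernels on the simplex: `k(s,t) = k(t,s)ᵀ` and
`∑ i j, u_iᵀ k(t_i,t_j) u_j ≥ 0` for all finite families of points and vectors. -/
structure IsMatrixKernel {m : ℕ} (k : Simplex m → Simplex m → (Vec m →L[ℝ] Vec m)) : Prop where
  symm : ∀ s t, k s t = ContinuousLinearMap.adjoint (k t s)
  nonneg : ∀ (n : ℕ) (t : Fin n → Simplex m) (u : Fin n → Vec m),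
    0 ≤ ∑ i, ∑ j, ⟪u i, k (t i) (t j) (u j)⟫

/-- A matrix-valued kernel is positive semidefinite in the sense that Mathlib uses to construct
the associated reproducing kernel Hilbert space. -/
theorem IsMatrixKernel.posSemidef {m : ℕ} {k : Simplex m → Simplex m → (Vec m →L[ℝ] Vec m)}
    (hk : IsMatrixKernel k) : (Matrix.of k).PosSemidef := by
  have key := (RKHS.posSemidef_tfae (K := Matrix.of k)).out 0 2
  refine key.mpr ⟨?_, fun vv => ?_⟩
  · ext1 s t
    simpa [Matrix.conjTranspose_apply, ContinuousLinearMap.star_eq_adjoint]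
      using (hk.symm s t).symm
  · have h := hk.nonneg vv.support.card (fun i => (vv.support.equivFin.symm i : Simplex m))
      (fun i => vv (vv.support.equivFin.symm i : Simplex m))
    have e : ∀ f : Simplex m → ℝ,
        ∑ i, f (vv.support.equivFin.symm i : Simplex m) = ∑ x ∈ vv.support, f x := by
      intro f
      rw [← Finset.sum_coe_sort vv.support f]
      exact Equiv.sum_comp vv.support.equivFin.symm (fun x => f x)
    rw [e (fun x => ∑ j, ⟪vv x, k x (vv.support.equivFin.symm j : Simplex m)
      (vv (vv.support.equivFin.symm j : Simplex m))⟫)] at h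
    simp only [fun x : Simplex m => e (fun y => ⟪vv x, k x y (vv y)⟫)] at h
    rw [Finset.sum_comm] at h
    simpa [Finsupp.sum, real_inner_comm] using h

/-- The closed unit ball, as a set of functions `Δ^m → ℝ^m`, of the reproducing kernel Hilbert
space with reproducing kernel `k`. -/
def rkhsUnitBall {m : ℕ} (k : Simplex m → Simplex m → (Vec m →L[ℝ] Vec m))
    (hk : IsMatrixKernel k) : Set (Simplex m → Vec m) :=
  haveI : Fact (Matrix.of k).PosSemidef := ⟨hk.posSemidef⟩
  {f | ∃ φ : RKHS.OfKernel (𝕜 := ℝ) (Matrix.of k), ‖φ‖ ≤ 1 ∧ (φ : Simplex m → Vec m) = f}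

/-- The (extended) norm `‖k‖_{ν,p}`: the `L^p(ν)` norm of `t ↦ ‖k(t,t)‖^{1/2}`. -/
def kernelNorm {m : ℕ} (k : Simplex m → Simplex m → (Vec m →L[ℝ] Vec m)) (p : ℝ≥0∞)
    (ν : Measure (Simplex m)) : ℝ≥0∞ :=
  eLpNorm (fun t => √‖k t t‖) p ν

section Model

variable {Ω 𝒳 : Type*} [MeasurableSpace Ω] [MeasurableSpace 𝒳] {m : ℕ}

/-- The miscalibration function `δ(t) = (μ_{Y|G}({y}|t) - t_y)_y`, for a regular conditional
distribution of the class `Y` given the prediction `G`. -/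
def miscalibration [NeZero m] (μ : Measure Ω) [IsFiniteMeasure μ]
    (G : Ω → Simplex m) (Y : Ω → Fin m) (t : Simplex m) : Vec m :=
  WithLp.toLp 2 (fun y => (condDistrib Y G μ t).real {y} - (t : Fin m → ℝ) y)

/-- The calibration error `CE[F] = sup_{f ∈ F} E⟨δ(G), f(G)⟩`, possibly infinite. -/
def calibrationError [NeZero m] (μ : Measure Ω) [IsFiniteMeasure μ]
    (G : Ω → Simplex m) (Y : Ω → Fin m) (F : Set (Simplex m → Vec m)) : EReal :=
  ⨆ f ∈ F, ((∫ ω, ⟪miscalibration μ G Y (G ω), f (G ω)⟫ ∂μ : ℝ) : EReal)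

/-- The kernel calibration error: the calibration error with respect to the unit ball of the
reproducing kernel Hilbert space with kernel `k`. -/
def kce [NeZero m] (μ : Measure Ω) [IsFiniteMeasure μ] (G : Ω → Simplex m) (Y : Ω → Fin m)
    (k : Simplex m → Simplex m → (Vec m →L[ℝ] Vec m)) (hk : IsMatrixKernel k) : EReal :=
  calibrationError μ G Y (rkhsUnitBall k hk)

/-- The squared kernel calibration error (meaningful when the kernel calibration error is
finite). -/
def skce [NeZero m] (μ : Measure Ω) [IsFiniteMeasure μ] (G : Ω → Simplex m) (Y : Ω → Fin m)
    (k : Simplex m → Simplex m → (Vec m →L[ℝ] Vec m)) (hk : IsMatrixKernel k) : ℝ :=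
  (kce μ G Y k hk).toReal ^ 2

/-- The residual `δ(x,y) = e_y - g(x)` of one labelled input. -/
def residual (g : 𝒳 → Simplex m) (z : 𝒳 × Fin m) : Vec m :=
  EuclideanSpace.single z.2 (1 : ℝ) - (g z.1).toVec

/-- The kernel term `h((x,y),(x',y')) = ⟨δ(x,y), k(g(x),g(x')) δ(x',y')⟩`. -/
def kernelTerm (k : Simplex m → Simplex m → (Vec m →L[ℝ] Vec m)) (g : 𝒳 → Simplex m)
    (z z' : 𝒳 × Fin m) : ℝ :=
  ⟪residual g z, k (g z.1) (g z'.1) (residual g z')⟫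

/-- The unbiased estimator `(n(n-1))⁻¹ ∑_{i ≠ j} h(z_i,z_j)`, evaluated at the first `n` terms of
the data sequence `z`. -/
def skceUnbiased (k : Simplex m → Simplex m → (Vec m →L[ℝ] Vec m)) (g : 𝒳 → Simplex m)
    (n : ℕ) (z : ℕ → 𝒳 × Fin m) : ℝ :=
  ((n : ℝ) * ((n : ℝ) - 1))⁻¹ *
    ∑ ij ∈ (Finset.range n).offDiag, kernelTerm k g (z ij.1) (z ij.2)

/-- `ζ₁ = E[h(Z,Z') h(Z,Z'')] - SKCE²`, where `Z, Z', Z''` are independent copies of `(X,Y)`. -/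
def zetaOne [NeZero m] (μ : Measure Ω) [IsFiniteMeasure μ] (X : Ω → 𝒳) (Y : Ω → Fin m)
    (k : Simplex m → Simplex m → (Vec m →L[ℝ] Vec m)) (hk : IsMatrixKernel k)
    (g : 𝒳 → Simplex m) : ℝ :=
  (∫ z, kernelTerm k g z.1 z.2.1 * kernelTerm k g z.1 z.2.2
      ∂((μ.map (fun ω => (X ω, Y ω))).prod
        ((μ.map (fun ω => (X ω, Y ω))).prod (μ.map (fun ω => (X ω, Y ω))))))
    - skce μ (fun ω => g (X ω)) Y k hk ^ 2

end Model

end CalibrationError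

end

/-!
Two ingredients combine: a Hilbert space representation of the kernel calibration error and the
central limit theorem for U-statistics of order two.

**Hilbert space side.** Elements of `ℋ` are measurable, because the kernel sections are and
`ℋ`-limits are pointwise limits (`RKHS.measurable_coe_of_measurable_kernel`); they are integrable
because `‖f t‖ ≤ ‖f‖ √‖k(t,t)‖`. Hence `f ↦ 𝔼⟪e_Y - G, f(G)⟫` is a bounded functional on `ℋ` and is
represented by some `ξ ∈ ℋ` (`RKHS.exists_inner_eq_integral`). Conditioning on `G` replaces
`e_Y - G` by the miscalibration (`CalibrationError.integral_inner_miscalibration`), so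
`KCE = sup_{‖f‖ ≤ 1} ⟪ξ, f⟫ = ‖ξ‖` and `SKCE = ‖ξ‖²`. By the reproducing property the same `ξ`
computes the projection of `h`: `h₁(z') := 𝔼 h(Z, z') = ⟪δ(z'), ξ(g(x'))⟫` for every `z' = (x', y')`,
and therefore `𝔼 h₁(Z) = ⟪ξ, ξ⟫ = SKCE`. Integrating `h(Z, Z') h(Z, Z'')` over `Z'` and `Z''` first
gives `h₁(Z)²`, so that `h₁` is square-integrable and `ζ₁ = Var h₁(Z) ≥ 0`
(`UStatistic.memLp_projection_and_integral_sq`).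

**Probabilistic side.** Write `h(z, z') = h₁(z) + h₁(z') - SKCE + r(z, z')`. The remainder `r` is
degenerate, `𝔼 r(Z, z') = 0`, so `r(Z_i, Z_j)` and `r(Z_k, Z_l)` are uncorrelated unless
`{i, j} = {k, l}`, and the remainder of the U-statistic has second moment `O(n⁻²)`
(`UStatistic.integral_sq_sum_offDiag_le`). At scale `√n` only the linear part
`2 n⁻¹ ∑ i, (h₁(Z_i) - SKCE)` survives, to which the classical central limit theorem applies; this
is `UStatistic.tendstoInDistribution`. If `ζ₁ = 0`, the limit is the point mass at `0`, which is
`gaussianReal 0 0`.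
-/

/-! ### Averages in reproducing kernel Hilbert spaces -/

namespace RKHS

variable {T V H : Type*} [NormedAddCommGroup V] [InnerProductSpace ℝ V] [CompleteSpace V]
  [NormedAddCommGroup H] [InnerProductSpace ℝ H] [CompleteSpace H] [RKHS ℝ H T V]
  [MeasurableSpace T]

/-- The diagonal of the kernel need not be measurable: the `L¹` norm of its square root is
then a lower integral, which still dominates the integral of the measurable function `f`. -/
theorem eLpNorm_one_coe_le (ν : Measure T) (f : H) :
    eLpNorm (f : T → V) 1 ν ≤ ‖f‖ₑ * eLpNorm (fun t => √‖kernel H t t‖) 1 ν := by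
  simp only [eLpNorm_one_eq_lintegral_enorm]
  rw [← lintegral_const_mul' _ _ enorm_ne_top]
  refine lintegral_mono fun t => ?_
  rw [← enorm_norm f, ← enorm_norm (f t), ← enorm_mul,
    Real.enorm_of_nonneg (norm_nonneg _),
    Real.enorm_of_nonneg (mul_nonneg (norm_nonneg _) (Real.sqrt_nonneg _))]
  exact ENNReal.ofReal_le_ofReal (norm_apply_le f t)

variable [MeasurableSpace V] [BorelSpace V] [SecondCountableTopology V]

/-- Norm convergence in `H` is stronger than pointwise convergence and the kernel functions span a
dense subspace, so measurability of the kernel sections passes to all of `H`. -/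
theorem measurable_coe_of_measurable_kernel
    (hmeas : ∀ (t : T) (u : V), Measurable (fun s => kernel H s t u)) (f : H) :
    Measurable (f : T → V) := by
  have hspan : ∀ φ ∈ Submodule.span ℝ {kerFun H x v | (x : T) (v : V)},
      Measurable (φ : T → V) := by
    intro φ hφ
    induction hφ using Submodule.span_induction with
    | mem φ hφ =>
      obtain ⟨x, v, rfl⟩ := hφ
      rw [show (kerFun H x v : T → V) = fun s => kernel H s x v from funext (kerFun_apply H x v)]
      exact hmeas x v
    | zero => rw [coe_zero]; exact measurable_zero
    | add φ ψ _ _ h₁ h₂ => rw [coe_add]; exact h₁.add h₂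
    | smul c φ _ h => rw [coe_smul]; exact h.const_smul c
  have hf : f ∈ closure (Submodule.span ℝ {kerFun H x v | (x : T) (v : V)} : Set H) := by
    rw [← Submodule.topologicalClosure_coe, kerFun_dense]
    trivial
  obtain ⟨φ, hφ, hlim⟩ := mem_closure_iff_seq_limit.1 hf
  refine measurable_of_tendsto_metrizable (fun n => hspan _ (hφ n)) (tendsto_pi_nhds.2 fun t => ?_)
  exact ((continuous_eval t).tendsto f).comp hlim

theorem memLp_one_coe (hmeas : ∀ (t : T) (u : V), Measurable (fun s => kernel H s t u))
    {ν : Measure T} (hν : eLpNorm (fun t => √‖kernel H t t‖) 1 ν < ∞) (f : H) :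
    MemLp (f : T → V) 1 ν :=
  ⟨(measurable_coe_of_measurable_kernel hmeas f).aestronglyMeasurable,
    (eLpNorm_one_coe_le ν f).trans_lt (ENNReal.mul_lt_top enorm_lt_top hν)⟩

/-- A bounded random weight `a` at a random location `τ` can be averaged inside `H`: the functional
`f ↦ ∫ ⟪a, f ∘ τ⟫` is bounded, hence represented by an element of `H`. -/
theorem exists_inner_eq_integral (hmeas : ∀ (t : T) (u : V), Measurable (fun s => kernel H s t u))
    {S : Type*} [MeasurableSpace S] {ν : Measure S} {a : S → V} {τ : S → T} {C : ℝ}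
    (ha : Measurable a) (haC : ∀ s, ‖a s‖ ≤ C) (hτ : Measurable τ)
    (hν : eLpNorm (fun t => √‖kernel H t t‖) 1 (ν.map τ) < ∞) :
    ∃ ξ : H, ∀ f : H, Integrable (fun s => ⟪a s, f (τ s)⟫) ν ∧
      ⟪ξ, f⟫ = ∫ s, ⟪a s, f (τ s)⟫ ∂ν := by
  have hcomp : ∀ f : H, Integrable (fun s => f (τ s)) ν := fun f =>
    (memLp_one_iff_integrable.1 (memLp_one_coe hmeas hν f)).comp_measurable hτ
  have hbd : ∀ (f : H) s, ‖⟪a s, f (τ s)⟫‖ ≤ C * ‖f (τ s)‖ := fun f s =>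
    (norm_inner_le_norm _ _).trans (mul_le_mul_of_nonneg_right (haC s) (norm_nonneg _))
  have hint : ∀ f : H, Integrable (fun s => ⟪a s, f (τ s)⟫) ν := fun f =>
    ((hcomp f).norm.const_mul C).mono'
      (ha.aestronglyMeasurable.inner (hcomp f).aestronglyMeasurable) (ae_of_all _ (hbd f))
  let L₀ : H →ₗ[ℝ] ℝ :=
    { toFun := fun f => ∫ s, ⟪a s, f (τ s)⟫ ∂ν
      map_add' := fun f f' => by
        rw [← integral_add (hint f) (hint f')]
        simp only [coe_add, Pi.add_apply, inner_add_right]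
      map_smul' := fun c f => by
        simp only [coe_smul, Pi.smul_apply, real_inner_smul_right, integral_const_mul,
          RingHom.id_apply, smul_eq_mul] }
  let M := (eLpNorm (fun t => √‖kernel H t t‖) 1 (ν.map τ)).toReal
  have hL : ∀ f, ‖L₀ f‖ ≤ (|C| * M) * ‖f‖ := by
    intro f
    have h1 : ∫ s, ‖f (τ s)‖ ∂ν ≤ ‖f‖ * M := by
      have hm := memLp_one_coe hmeas hν f
      rw [← integral_map (f := fun t => ‖f t‖) hτ.aemeasurable hm.1.norm,
        integral_norm_eq_lintegral_enorm hm.1, ← eLpNorm_one_eq_lintegral_enorm,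
        ← toReal_enorm f, ← ENNReal.toReal_mul]
      exact ENNReal.toReal_mono (ENNReal.mul_ne_top enorm_ne_top hν.ne) (eLpNorm_one_coe_le _ f)
    calc ‖L₀ f‖ ≤ ∫ s, ‖⟪a s, f (τ s)⟫‖ ∂ν := norm_integral_le_integral_norm _
      _ ≤ ∫ s, |C| * ‖f (τ s)‖ ∂ν := by
          refine integral_mono (hint f).norm ((hcomp f).norm.const_mul _) fun s => ?_
          exact (hbd f s).trans (mul_le_mul_of_nonneg_right (le_abs_self C) (norm_nonneg _))
      _ = |C| * ∫ s, ‖f (τ s)‖ ∂ν := integral_const_mul _ _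
      _ ≤ |C| * (‖f‖ * M) := mul_le_mul_of_nonneg_left h1 (abs_nonneg C)
      _ = (|C| * M) * ‖f‖ := by ring
  refine ⟨(InnerProductSpace.toDual ℝ H).symm (L₀.mkContinuous _ hL), fun f => ⟨hint f, ?_⟩⟩
  rw [InnerProductSpace.toDual_symm_apply]
  rfl

end RKHS

/-- The dual description of the norm, in the extended reals. -/
theorem iSup_inner_unitBall {H : Type*} [NormedAddCommGroup H] [InnerProductSpace ℝ H] (ξ : H) :
    ⨆ (φ : H) (_ : ‖φ‖ ≤ 1), ((⟪ξ, φ⟫ : ℝ) : EReal) = (‖ξ‖ : ℝ) := by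
  refine le_antisymm (iSup₂_le fun φ hφ => ?_) ?_
  · exact EReal.coe_le_coe_iff.2 ((real_inner_le_norm ξ φ).trans
      (mul_le_of_le_one_right (norm_nonneg ξ) hφ))
  · refine le_iSup₂_of_le (‖ξ‖⁻¹ • ξ) ?_ ?_
    · rw [norm_smul, norm_inv, norm_norm]
      exact inv_mul_le_one
    · rw [EReal.coe_le_coe_iff, real_inner_smul_right, real_inner_self_eq_norm_mul_norm]
      rcases eq_or_ne ‖ξ‖ 0 with h | h
      · simp [h]
      · rw [inv_mul_cancel_left₀ h]

/-! ### Residuals and miscalibration -/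

namespace CalibrationError

variable {Ω 𝒳 : Type*} [MeasurableSpace Ω] [MeasurableSpace 𝒳] {m : ℕ}

theorem Simplex.measurable_toVec : Measurable (Simplex.toVec : Simplex m → Vec m) :=
  (PiLp.continuous_toLp 2 _).measurable.comp measurable_subtype_coe

theorem measurable_residual {g : 𝒳 → Simplex m} (hg : Measurable g) :
    Measurable (residual g) := by
  refine Measurable.sub ?_ (Simplex.measurable_toVec.comp (hg.comp measurable_fst))
  exact (measurable_of_countable fun y : Fin m => EuclideanSpace.single y (1 : ℝ)).comp
    measurable_snd

theorem Simplex.norm_toVec_le (t : Simplex m) : ‖t.toVec‖ ≤ 1 := by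
  have h01 : ∀ y, (t : Fin m → ℝ) y ^ 2 ≤ (t : Fin m → ℝ) y := fun y => by
    have h0 := t.2.1 y
    have h1 : (t : Fin m → ℝ) y ≤ 1 := by
      rw [← t.2.2]
      exact Finset.single_le_sum (fun z _ => t.2.1 z) (Finset.mem_univ y)
    exact pow_le_of_le_one h0 h1 two_ne_zero
  rw [EuclideanSpace.norm_eq, Real.sqrt_le_one]
  calc ∑ y, ‖t.toVec y‖ ^ 2 = ∑ y, (t : Fin m → ℝ) y ^ 2 := by
        simp [Simplex.toVec]
    _ ≤ ∑ y, (t : Fin m → ℝ) y := Finset.sum_le_sum fun y _ => h01 y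
    _ = 1 := t.2.2

theorem norm_residual_le {𝒳 : Type*} (g : 𝒳 → Simplex m) (z : 𝒳 × Fin m) : ‖residual g z‖ ≤ 2 := by
  refine (norm_sub_le _ _).trans ?_
  have := (g z.1).norm_toVec_le
  rw [PiLp.norm_single, norm_one]
  linarith

/-- Conditioning on the prediction: against functions of `G = g(X)`, the miscalibration
`ℙ[Y = · | G] - G` integrates like the observable residual `e_Y - G`. -/
theorem integral_inner_miscalibration [NeZero m] {μ : Measure Ω} [IsProbabilityMeasure μ]
    {X : Ω → 𝒳} (hX : Measurable X) {Y : Ω → Fin m} (hY : Measurable Y)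
    {g : 𝒳 → Simplex m} (hg : Measurable g) {f : Simplex m → Vec m} (hf : Measurable f)
    (hint : Integrable (fun ω => ⟪residual g (X ω, Y ω), f (g (X ω))⟫) μ) :
    ∫ ω, ⟪miscalibration μ (fun ω => g (X ω)) Y (g (X ω)), f (g (X ω))⟫ ∂μ =
      ∫ ω, ⟪residual g (X ω, Y ω), f (g (X ω))⟫ ∂μ := by
  set G : Ω → Simplex m := fun ω => g (X ω) with hG
  have hGm : Measurable G := hg.comp hX
  let F : Simplex m × Fin m → ℝ := fun p => ⟪residual id p, f p.1⟫
  have hF : Measurable F :=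
    (measurable_residual measurable_id).inner (hf.comp measurable_fst)
  have hFint : Integrable F (μ.map fun ω => (G ω, Y ω)) :=
    (integrable_map_measure hF.aestronglyMeasurable (hGm.prodMk hY).aemeasurable).2 hint
  have hinner : ∀ t, ∫ y, F (t, y) ∂(condDistrib Y G μ t) = ⟪miscalibration μ G Y t, f t⟫ := by
    intro t
    have hs : ∑ y, (condDistrib Y G μ t).real {y} = 1 := by
      rw [sum_measureReal_singleton]; simp
    have hvec : ∑ y, (condDistrib Y G μ t).real {y} • residual id (t, y) =
        miscalibration μ G Y t := by
      simp only [residual, smul_sub, Finset.sum_sub_distrib, ← Finset.sum_smul, hs, one_smul]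
      ext y
      simp [miscalibration, Simplex.toVec, Pi.single_apply]
    rw [integral_fintype Integrable.of_finite, ← hvec, sum_inner]
    simp [F, real_inner_smul_left]
  have h1 : ∫ ω, ⟪residual g (X ω, Y ω), f (g (X ω))⟫ ∂μ
      = ∫ p, F p ∂(μ.map fun ω => (G ω, Y ω)) :=
    (integral_map (hGm.prodMk hY).aemeasurable hF.aestronglyMeasurable).symm
  rw [h1, ← compProd_map_condDistrib hY.aemeasurable]
  rw [Measure.integral_compProd (by rwa [compProd_map_condDistrib hY.aemeasurable])]
  simp only [hinner]
  rw [integral_map hGm.aemeasurable]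
  have : StronglyMeasurable fun t => ∫ y, F (t, y) ∂(condDistrib Y G μ t) :=
    hF.stronglyMeasurable.integral_condDistrib
  simp only [hinner] at this
  exact this.aestronglyMeasurable

theorem kernelTerm_comm {𝒳 : Type*} {m : ℕ} {k : Simplex m → Simplex m → (Vec m →L[ℝ] Vec m)}
    (hk : IsMatrixKernel k) (g : 𝒳 → Simplex m) (z z' : 𝒳 × Fin m) :
    kernelTerm k g z z' = kernelTerm k g z' z := by
  rw [kernelTerm, kernelTerm, hk.symm, ContinuousLinearMap.adjoint_inner_right, real_inner_comm]

end CalibrationError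

/-! ### Central limit theorem for U-statistics of order two -/

namespace UStatistic

variable {Ω E : Type*} [MeasurableSpace Ω] [MeasurableSpace E] {P : Measure Ω}
  [IsProbabilityMeasure P] {ν : Measure E} {D : ℕ → Ω → E}

theorem hasLaw_pair (hD : iIndepFun D P) (hlaw : ∀ i, HasLaw (D i) ν P) {i j : ℕ} (hij : i ≠ j) :
    HasLaw (fun ω => (D i ω, D j ω)) (ν.prod ν) P where
  aemeasurable := (hlaw i).aemeasurable.prodMk (hlaw j).aemeasurable
  map_eq := by
    rw [(indepFun_iff_map_prod_eq_prod_map_map (hlaw i).aemeasurable (hlaw j).aemeasurable).1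
      (hD.indepFun hij), (hlaw i).map_eq, (hlaw j).map_eq]

theorem memLp_comp_pair {r : E × E → ℝ} {p : ℝ≥0∞} (hr : MemLp r p (ν.prod ν))
    (hD : iIndepFun D P) (hlaw : ∀ i, HasLaw (D i) ν P) {i j : ℕ} (hij : i ≠ j) :
    MemLp (fun ω => r (D i ω, D j ω)) p P := by
  have h := hasLaw_pair hD hlaw hij
  exact MemLp.comp_of_map (g := r) (h.map_eq.symm ▸ hr) h.aemeasurable

theorem integral_comp_pair {r : E × E → ℝ} (hr : AEStronglyMeasurable r (ν.prod ν))
    (hD : iIndepFun D P) (hlaw : ∀ i, HasLaw (D i) ν P) {i j : ℕ} (hij : i ≠ j) :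
    ∫ ω, r (D i ω, D j ω) ∂P = ∫ p, r p ∂(ν.prod ν) :=
  (hasLaw_pair hD hlaw hij).integral_comp hr

variable [IsProbabilityMeasure ν]

/-- If the index `i` occurs only once among `i, j, k, l`, integrating out `D i` first kills the
product. -/
theorem integral_mul_eq_zero_of_notMem {r r' : E × E → ℝ} (hr : MemLp r 2 (ν.prod ν))
    (hr' : MemLp r' 2 (ν.prod ν)) (hdeg : ∀ᵐ y ∂ν, ∫ x, r (x, y) ∂ν = 0)
    (hD : iIndepFun D P) (hlaw : ∀ i, HasLaw (D i) ν P) {i j k l : ℕ}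
    (hij : i ≠ j) (hik : i ≠ k) (hil : i ≠ l) (hkl : k ≠ l) :
    ∫ ω, r (D i ω, D j ω) * r' (D k ω, D l ω) ∂P = 0 := by
  let W : Ω → E × (E × E) := fun ω => (D j ω, (D k ω, D l ω))
  have hW : AEMeasurable W P := (hlaw j).aemeasurable.prodMk
    ((hlaw k).aemeasurable.prodMk (hlaw l).aemeasurable)
  have hindep : IndepFun (D i) W P := by
    have h := hD.indepFun_finset₀ {i} {j, k, l} (by simp [hij, hik, hil])
      (fun i => (hlaw i).aemeasurable)
    exact h.comp (φ := fun v : ({i} : Finset ℕ) → E => v ⟨i, by simp⟩)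
      (ψ := fun v : ({j, k, l} : Finset ℕ) → E =>
        (v ⟨j, by simp⟩, (v ⟨k, by simp⟩, v ⟨l, by simp⟩)))
      (by fun_prop) (by fun_prop)
  have : IsProbabilityMeasure (P.map W) := Measure.isProbabilityMeasure_map hW
  have hmap : P.map (fun ω => (D i ω, W ω)) = ν.prod (P.map W) := by
    rw [(indepFun_iff_map_prod_eq_prod_map_map (hlaw i).aemeasurable hW).1 hindep, (hlaw i).map_eq]
  have hWj : (P.map W).map Prod.fst = ν := by
    rw [AEMeasurable.map_map_of_aemeasurable measurable_fst.aemeasurable hW]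
    exact (hlaw j).map_eq
  have hWkl : (P.map W).map Prod.snd = ν.prod ν := by
    rw [AEMeasurable.map_map_of_aemeasurable measurable_snd.aemeasurable hW]
    exact (hasLaw_pair hD hlaw hkl).map_eq
  let F : E × (E × (E × E)) → ℝ := fun p => r (p.1, p.2.1) * r' p.2.2
  have hq1 : MeasurePreserving (fun p : E × (E × (E × E)) => (p.1, p.2.1))
      (ν.prod (P.map W)) (ν.prod ν) :=
    (MeasurePreserving.id ν).prod ⟨measurable_fst, hWj⟩
  have hq2 : MeasurePreserving (fun p : E × (E × (E × E)) => p.2.2)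
      (ν.prod (P.map W)) (ν.prod ν) :=
    (MeasurePreserving.mk measurable_snd hWkl).comp measurePreserving_snd
  have hF : Integrable F (ν.prod (P.map W)) :=
    (hr.comp_measurePreserving hq1).integrable_mul (hr'.comp_measurePreserving hq2)
  calc ∫ ω, r (D i ω, D j ω) * r' (D k ω, D l ω) ∂P
      = ∫ p, F p ∂(ν.prod (P.map W)) := by
        rw [← hmap, integral_map ((hlaw i).aemeasurable.prodMk hW) (hmap ▸ hF.1)]
    _ = ∫ w, ∫ x, F (x, w) ∂ν ∂(P.map W) := integral_prod_symm _ hF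
    _ = 0 := by
        refine integral_eq_zero_of_ae ?_
        have hdegW : ∀ᵐ w ∂(P.map W), ∫ x, r (x, w.1) ∂ν = 0 :=
          ae_of_ae_map (p := fun y => ∫ x, r (x, y) ∂ν = 0) measurable_fst.aemeasurable
            (by rwa [hWj])
        filter_upwards [hdegW] with w hw
        simp only [F, integral_mul_const, hw, zero_mul, Pi.zero_apply]

/-- The second moment of the degenerate part: two terms are correlated only if they use the same
pair of observations, so that the double sum over pairs of indices is quadratic in `n` and not of
order `n ^ 4`. -/
theorem integral_sq_sum_offDiag_le {r : E × E → ℝ} (hr : MemLp r 2 (ν.prod ν))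
    (hdeg : ∀ᵐ y ∂ν, ∫ x, r (x, y) ∂ν = 0) (hsymm : ∀ x y, r (x, y) = r (y, x))
    (hD : iIndepFun D P) (hlaw : ∀ i, HasLaw (D i) ν P) (n : ℕ) :
    ∫ ω, (∑ p ∈ (Finset.range n).offDiag, r (D p.1 ω, D p.2 ω)) ^ 2 ∂P ≤
      2 * (n : ℝ) ^ 2 * ∫ p, r p ^ 2 ∂(ν.prod ν) := by
  set S := (Finset.range n).offDiag with hS
  set C := ∫ p, r p ^ 2 ∂(ν.prod ν) with hC
  have hC0 : 0 ≤ C := integral_nonneg fun _ => sq_nonneg _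
  have hne : ∀ p ∈ S, p.1 ≠ p.2 := fun p hp => (Finset.mem_offDiag.1 hp).2.2
  have hL2 : ∀ p ∈ S, MemLp (fun ω => r (D p.1 ω, D p.2 ω)) 2 P := fun p hp =>
    memLp_comp_pair hr hD hlaw (hne p hp)
  have hself : ∀ p ∈ S, ∫ ω, r (D p.1 ω, D p.2 ω) * r (D p.1 ω, D p.2 ω) ∂P = C := by
    intro p hp
    rw [hC, ← integral_comp_pair (r := fun p => r p ^ 2) (hr.1.pow 2) hD hlaw (hne p hp)]
    simp only [sq]
  have hterm : ∀ p ∈ S, ∀ q ∈ S,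
      ∫ ω, r (D p.1 ω, D p.2 ω) * r (D q.1 ω, D q.2 ω) ∂P ≤
        (if q = p then C else 0) + if q = p.swap then C else 0 := by
    rintro ⟨i, j⟩ hp ⟨k, l⟩ hq
    have hij := hne _ hp
    have hkl := hne _ hq
    by_cases h1 : (k, l) = (i, j)
    · rw [h1, if_pos rfl, hself _ hp]
      split_ifs <;> linarith
    by_cases h2 : (k, l) = Prod.swap (i, j)
    · rw [if_pos h2, if_neg h1, zero_add]
      simp only [Prod.swap_prod_mk, Prod.mk.injEq] at h2
      obtain ⟨rfl, rfl⟩ := h2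
      simp only [hsymm (D k _) (D l _)]
      exact (hself (l, k) hp).le
    rw [if_neg h1, if_neg h2, add_zero]
    simp only [Prod.swap_prod_mk, Prod.mk.injEq] at h1 h2 hij hkl
    -- some index of the first pair is missing from the second one
    rcases (by lia : (i ≠ k ∧ i ≠ l) ∨ (j ≠ k ∧ j ≠ l)) with h | h
    · exact (integral_mul_eq_zero_of_notMem hr hr hdeg hD hlaw hij h.1 h.2 hkl).le
    · simp only [hsymm (D i _) (D j _)]
      exact (integral_mul_eq_zero_of_notMem hr hr hdeg hD hlaw hij.symm h.1 h.2 hkl).le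
  calc ∫ ω, (∑ p ∈ S, r (D p.1 ω, D p.2 ω)) ^ 2 ∂P
      = ∑ p ∈ S, ∑ q ∈ S, ∫ ω, r (D p.1 ω, D p.2 ω) * r (D q.1 ω, D q.2 ω) ∂P := by
        simp only [sq, Finset.sum_mul_sum]
        have hint : ∀ p ∈ S, ∀ q ∈ S,
            Integrable (fun ω => r (D p.1 ω, D p.2 ω) * r (D q.1 ω, D q.2 ω)) P :=
          fun p hp q hq => (hL2 p hp).integrable_mul (hL2 q hq)
        rw [integral_finsetSum _ fun p hp => integrable_finsetSum _ (hint p hp)]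
        exact Finset.sum_congr rfl fun p hp => integral_finsetSum _ (hint p hp)
    _ ≤ ∑ p ∈ S, ∑ q ∈ S, ((if q = p then C else 0) + if q = p.swap then C else 0) :=
        Finset.sum_le_sum fun p hp => Finset.sum_le_sum fun q hq => hterm p hp q hq
    _ ≤ ∑ p ∈ S, (C + C) := by
        refine Finset.sum_le_sum fun p _ => ?_
        rw [Finset.sum_add_distrib, Finset.sum_ite_eq', Finset.sum_ite_eq']
        refine add_le_add ?_ ?_ <;> split_ifs <;> linarith
    _ ≤ 2 * (n : ℝ) ^ 2 * C := by
        have hcard : (S.card : ℝ) ≤ (n : ℝ) ^ 2 := by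
          rw [hS, Finset.offDiag_card, Finset.card_range, sq]
          exact_mod_cast Nat.sub_le _ _
        rw [Finset.sum_const, nsmul_eq_mul]
        nlinarith

/-- The Hoeffding remainder is negligible at the scale `√n`. -/
theorem tendstoInMeasure_sqrt_mul_degenerate {r : E × E → ℝ} (hr : MemLp r 2 (ν.prod ν))
    (hdeg : ∀ᵐ y ∂ν, ∫ x, r (x, y) ∂ν = 0) (hsymm : ∀ x y, r (x, y) = r (y, x))
    (hD : iIndepFun D P) (hlaw : ∀ i, HasLaw (D i) ν P) :
    TendstoInMeasure P (fun (n : ℕ) ω => √(n : ℝ) * (((n : ℝ) * ((n : ℝ) - 1))⁻¹ *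
      ∑ p ∈ (Finset.range n).offDiag, r (D p.1 ω, D p.2 ω))) atTop 0 := by
  set C := ∫ p, r p ^ 2 ∂(ν.prod ν) with hC
  let Q : ℕ → Ω → ℝ := fun n ω => ∑ p ∈ (Finset.range n).offDiag, r (D p.1 ω, D p.2 ω)
  have hQ : ∀ n, MemLp (Q n) 2 P := fun n => memLp_finsetSum _ fun p hp =>
    memLp_comp_pair hr hD hlaw (Finset.mem_offDiag.1 hp).2.2
  let c : ℕ → ℝ := fun n => √(n : ℝ) * ((n : ℝ) * ((n : ℝ) - 1))⁻¹
  have hmem : ∀ n, MemLp (fun ω => c n * Q n ω) 2 P := fun n => (hQ n).const_mul _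
  have hfun : (fun (n : ℕ) ω => √(n : ℝ) * (((n : ℝ) * ((n : ℝ) - 1))⁻¹ *
      ∑ p ∈ (Finset.range n).offDiag, r (D p.1 ω, D p.2 ω))) = fun n ω => c n * Q n ω := by
    ext n ω; simp only [c, Q, mul_assoc]
  rw [hfun]
  refine tendstoInMeasure_of_tendsto_eLpNorm (p := 2) two_ne_zero
    (fun n => (hmem n).1) aestronglyMeasurable_zero ?_
  have hbound : ∀ᶠ n : ℕ in atTop, ∫ ω, (c n * Q n ω) ^ 2 ∂P ≤ 8 * C * (n : ℝ)⁻¹ := by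
    filter_upwards [eventually_ge_atTop 2] with n hn
    have hn' : (2 : ℝ) ≤ n := by exact_mod_cast hn
    have h := integral_sq_sum_offDiag_le hr hdeg hsymm hD hlaw n
    have hC0 : 0 ≤ C := integral_nonneg fun _ => sq_nonneg _
    simp only [mul_pow, integral_const_mul]
    have hc : c n ^ 2 = ((n : ℝ) * ((n : ℝ) - 1) ^ 2)⁻¹ := by
      have : (n : ℝ) - 1 ≠ 0 := by linarith
      simp only [c, mul_pow, Real.sq_sqrt (Nat.cast_nonneg n)]
      field_simp
    rw [hc]
    refine (mul_le_mul_of_nonneg_left h (by positivity)).trans ?_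
    -- `n - 1 ≥ n / 2`
    have h4 : (n : ℝ) ^ 2 ≤ 4 * ((n : ℝ) - 1) ^ 2 := by nlinarith
    have hpos : 0 < ((n : ℝ) - 1) ^ 2 := by nlinarith
    rw [mul_inv, ← hC, show (n : ℝ)⁻¹ * (((n : ℝ) - 1) ^ 2)⁻¹ * (2 * (n : ℝ) ^ 2 * C)
      = ((n : ℝ) ^ 2 / ((n : ℝ) - 1) ^ 2) * (2 * C * (n : ℝ)⁻¹) by field_simp]
    refine (mul_le_mul_of_nonneg_right ((div_le_iff₀ hpos).2 h4) (by positivity)).trans ?_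
    linarith
  have hlim : Tendsto (fun n : ℕ => ∫ ω, (c n * Q n ω) ^ 2 ∂P) atTop (𝓝 0) := by
    refine squeeze_zero' (Eventually.of_forall fun n => integral_nonneg fun _ => sq_nonneg _)
      hbound ?_
    simpa using tendsto_inv_atTop_nhds_zero_nat (𝕜 := ℝ).const_mul (8 * C)
  have heq : ∀ n, eLpNorm ((fun ω => c n * Q n ω) - 0) 2 P
      = ENNReal.ofReal (√(∫ ω, (c n * Q n ω) ^ 2 ∂P)) := by
    intro n
    rw [sub_zero, (hmem n).eLpNorm_eq_integral_rpow_norm two_ne_zero ENNReal.ofNat_ne_top]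
    simp [Real.sqrt_eq_rpow, ← abs_mul]
  simp only [heq]
  have := ENNReal.tendsto_ofReal (hlim.sqrt)
  simpa using this

theorem sum_offDiag_fst (f : ℕ → ℝ) (n : ℕ) :
    ∑ p ∈ (Finset.range n).offDiag, f p.1 = ((n : ℝ) - 1) * ∑ i ∈ Finset.range n, f i := by
  have h := Finset.sum_union (f := fun p : ℕ × ℕ => f p.1)
    (Finset.disjoint_diag_offDiag (Finset.range n))
  rw [Finset.diag_union_offDiag, Finset.sum_product, Finset.sum_diag] at h
  simp only [Finset.sum_const, Finset.card_range, nsmul_eq_mul, ← Finset.mul_sum] at h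
  linarith

theorem sum_offDiag_snd (f : ℕ → ℝ) (n : ℕ) :
    ∑ p ∈ (Finset.range n).offDiag, f p.2 = ((n : ℝ) - 1) * ∑ i ∈ Finset.range n, f i := by
  rw [← sum_offDiag_fst f n]
  refine Finset.sum_equiv (Equiv.prodComm ℕ ℕ) (fun p => ?_) fun p _ => rfl
  simp only [Finset.mem_offDiag, Equiv.prodComm_apply, Prod.fst_swap, Prod.snd_swap]
  tauto

/-- **Central limit theorem for U-statistics of order two** (Hoeffding). The limit variance is
`4 ζ₁`, where `ζ₁` is the variance of the projection `h₁(y) = ∫ h(x, y) dν(x)`. -/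
theorem tendstoInDistribution {h : E × E → ℝ} (hh : MemLp h 2 (ν.prod ν))
    (hsymm : ∀ x y, h (x, y) = h (y, x)) {h₁ : E → ℝ} (hh₁ : MemLp h₁ 2 ν)
    (hproj : ∀ᵐ y ∂ν, ∫ x, h (x, y) ∂ν = h₁ y)
    (hD : iIndepFun D P) (hlaw : ∀ i, HasLaw (D i) ν P) :
    TendstoInDistribution
      (fun (n : ℕ) ω => √(n : ℝ) * (((n : ℝ) * ((n : ℝ) - 1))⁻¹ *
        ∑ p ∈ (Finset.range n).offDiag, h (D p.1 ω, D p.2 ω) - ν[h₁]))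
      atTop (id : ℝ → ℝ) (fun _ => P) (gaussianReal 0 (4 * Var[h₁; ν]).toNNReal) := by
  set θ := ν[h₁] with hθ
  let r : E × E → ℝ := fun p => h p - h₁ p.1 - h₁ p.2 + θ
  have hr : MemLp r 2 (ν.prod ν) :=
    ((hh.sub (hh₁.comp_measurePreserving measurePreserving_fst)).sub
      (hh₁.comp_measurePreserving measurePreserving_snd)).add (memLp_const θ)
  have hrsymm : ∀ x y, r (x, y) = r (y, x) := fun x y => by
    simp only [r, hsymm x y]; ring
  have hint₁ : Integrable h₁ ν := hh₁.integrable one_le_two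
  have hrdeg : ∀ᵐ y ∂ν, ∫ x, r (x, y) ∂ν = 0 := by
    filter_upwards [hproj, (hh.integrable one_le_two).prod_left_ae] with y hy hyint
    have hsub : Integrable (fun x => h (x, y) - h₁ x) ν := hyint.sub hint₁
    have hsub' : Integrable (fun x => h (x, y) - h₁ x - h₁ y) ν := hsub.sub (integrable_const _)
    simp only [r]
    rw [integral_add hsub' (integrable_const _), integral_sub hsub (integrable_const _),
      integral_sub hyint hint₁, hy]
    simp [hθ]
  -- the linear part of the Hoeffding decomposition
  let ξ : ℕ → Ω → ℝ := fun i ω => 2 * h₁ (D i ω)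
  have hlawξ : ∀ i, P.map (ξ i) = ν.map (fun x => 2 * h₁ x) := by
    intro i
    have hm : AEMeasurable (fun x => 2 * h₁ x) (P.map (D i)) := by
      rw [(hlaw i).map_eq]; exact (hh₁.1.const_mul 2).aemeasurable
    have := AEMeasurable.map_map_of_aemeasurable hm (hlaw i).aemeasurable
    rw [(hlaw i).map_eq] at this
    exact this.symm
  have hh₁D : ∀ i, MemLp (fun ω => h₁ (D i ω)) 2 P := fun i =>
    MemLp.comp_of_map (g := h₁) ((hlaw i).map_eq.symm ▸ hh₁) (hlaw i).aemeasurable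
  have hξmem : ∀ i, MemLp (ξ i) 2 P := fun i => (hh₁D i).const_mul 2
  have hident : ∀ i, IdentDistrib (ξ i) (ξ 0) P P := fun i =>
    ⟨(hξmem i).1.aemeasurable, (hξmem 0).1.aemeasurable, by rw [hlawξ, hlawξ]⟩
  have hindepξ : iIndepFun ξ P := by
    refine hD.comp₀ (fun _ x => 2 * h₁ x) (fun i => (hlaw i).aemeasurable) fun i => ?_
    rw [(hlaw i).map_eq]; exact (hh₁.1.const_mul 2).aemeasurable
  have hmean : P[ξ 0] = 2 * θ := by
    simp only [ξ]
    rw [integral_const_mul, hθ]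
    congr 1
    exact (hlaw 0).integral_comp hh₁.1
  have hvarξ : Var[ξ 0; P] = 4 * Var[h₁; ν] := by
    simp only [ξ]
    rw [variance_const_mul]
    have hm : AEMeasurable h₁ (P.map (D 0)) := by
      rw [(hlaw 0).map_eq]; exact hh₁.1.aemeasurable
    have := variance_map hm (hlaw 0).aemeasurable
    rw [(hlaw 0).map_eq] at this
    rw [this]; norm_num [Function.comp_def]
  have hclt := tendstoInDistribution_inv_sqrt_mul_sum_sub (P := P) (X := ξ) (Y := (id : ℝ → ℝ))
    (P' := gaussianReal 0 (4 * Var[h₁; ν]).toNNReal)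
    (by rw [hvarξ]; exact HasLaw.id) (hξmem 0) hindepξ hident
  refine tendstoInDistribution_of_tendstoInMeasure_sub _ _ hclt ?_ ?_
  · have hrem := tendstoInMeasure_sqrt_mul_degenerate hr hrdeg hrsymm hD hlaw
    refine hrem.congr' ?_ EventuallyEq.rfl
    filter_upwards [eventually_ge_atTop 2] with n hn
    refine ae_of_all _ fun ω => ?_
    have hn' : (2 : ℝ) ≤ n := by exact_mod_cast hn
    have hn1 : (n : ℝ) - 1 ≠ 0 := by linarith
    have hs : √(n : ℝ) ≠ 0 := (Real.sqrt_pos.2 (by linarith)).ne'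
    have hsn : (n : ℝ) = √(n : ℝ) * √(n : ℝ) := (Real.mul_self_sqrt (Nat.cast_nonneg n)).symm
    have hinv : (√(n : ℝ))⁻¹ = √(n : ℝ) * (n : ℝ)⁻¹ := by
      nth_rewrite 3 [hsn]; field_simp
    simp only [Pi.sub_apply, r, ξ, hmean, Finset.sum_add_distrib, Finset.sum_sub_distrib,
      sum_offDiag_fst (fun i => h₁ (D i ω)), sum_offDiag_snd (fun i => h₁ (D i ω)),
      Finset.sum_const, Finset.offDiag_card, Finset.card_range, ← Finset.mul_sum, nsmul_eq_mul,
      Nat.cast_sub (Nat.le_mul_self n), Nat.cast_mul, hinv]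
    field_simp
    ring
  · intro n
    refine (AEMeasurable.sub_const (AEMeasurable.const_mul ?_ _) _).const_mul _
    exact Finset.aemeasurable_fun_sum _ fun p hp =>
      (memLp_comp_pair hh hD hlaw (Finset.mem_offDiag.1 hp).2.2).1.aemeasurable

/-- The products `h(z, z') h(z, z'')` are integrable for independent `z, z', z''`; integrating out
`z', z''` leaves the square of the projection, which is therefore square-integrable. -/
theorem memLp_projection_and_integral_sq {h : E × E → ℝ} (hh : MemLp h 2 (ν.prod ν)) {h₁ : E → ℝ}
    (hmeas : AEStronglyMeasurable h₁ ν) (hproj : ∀ x, ∫ y, h (x, y) ∂ν = h₁ x) :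
    MemLp h₁ 2 ν ∧
      ∫ z, h (z.1, z.2.1) * h (z.1, z.2.2) ∂(ν.prod (ν.prod ν)) = ∫ x, h₁ x ^ 2 ∂ν := by
  have hp1 : MeasurePreserving (fun z : E × (E × E) => (z.1, z.2.1)) (ν.prod (ν.prod ν))
      (ν.prod ν) := (MeasurePreserving.id ν).prod measurePreserving_fst
  have hp2 : MeasurePreserving (fun z : E × (E × E) => (z.1, z.2.2)) (ν.prod (ν.prod ν))
      (ν.prod ν) := (MeasurePreserving.id ν).prod measurePreserving_snd
  have hF : Integrable (fun z : E × (E × E) => h (z.1, z.2.1) * h (z.1, z.2.2))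
      (ν.prod (ν.prod ν)) :=
    (hh.comp_measurePreserving hp1).integrable_mul (hh.comp_measurePreserving hp2)
  have hsq : ∀ x, ∫ w : E × E, h (x, w.1) * h (x, w.2) ∂(ν.prod ν) = h₁ x ^ 2 := fun x => by
    rw [integral_prod_mul (fun y => h (x, y)) (fun y => h (x, y)), hproj, sq]
  refine ⟨(memLp_two_iff_integrable_sq hmeas).2 ?_, ?_⟩
  · simpa only [hsq] using hF.integral_prod_left
  · rw [integral_prod _ hF]
    simp only [hsq]

end UStatistic

/-! ### Asymptotic normality of the unbiased estimator -/

theorem mainTheorem8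
    {Ω Ω' 𝒳 : Type*} [MeasurableSpace Ω] [MeasurableSpace Ω'] [MeasurableSpace 𝒳]
    {m : ℕ} [NeZero m]
    -- the probability space of the pair `(X, Y)` and the model `g`
    (μ : Measure Ω) [IsProbabilityMeasure μ]
    (X : Ω → 𝒳) (hX : Measurable X) (Y : Ω → Fin m) (hY : Measurable Y)
    (g : 𝒳 → CalibrationError.Simplex m) (hg : Measurable g)
    -- the kernel
    (k : CalibrationError.Simplex m → CalibrationError.Simplex m →
      (CalibrationError.Vec m →L[ℝ] CalibrationError.Vec m))
    (hk : CalibrationError.IsMatrixKernel k)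
    (hk_meas : ∀ (t : CalibrationError.Simplex m) (u : CalibrationError.Vec m),
      Measurable (fun s => k s t u))
    (hk_norm : CalibrationError.kernelNorm k 1 (μ.map (fun ω => g (X ω))) < ∞)
    -- finite variance of `h(Z, Z')` for independent copies `Z`, `Z'` of `(X, Y)`
    (hvar : MemLp
      (fun p : (𝒳 × Fin m) × (𝒳 × Fin m) => CalibrationError.kernelTerm k g p.1 p.2) 2
      ((μ.map (fun ω => (X ω, Y ω))).prod (μ.map (fun ω => (X ω, Y ω)))))
    -- the data: i.i.d. copies of `(X, Y)`
    (P : Measure Ω') [IsProbabilityMeasure P]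
    (D : ℕ → Ω' → 𝒳 × Fin m) (hD_indep : iIndepFun D P)
    (hD_ident : ∀ i, IdentDistrib (D i) (fun ω => (X ω, Y ω)) P μ) :
    -- the kernel calibration error is well defined and finite
    (∀ f ∈ CalibrationError.rkhsUnitBall k hk, MemLp f 1 (μ.map (fun ω => g (X ω)))) ∧
    CalibrationError.kce μ (fun ω => g (X ω)) Y k hk ≠ ⊤ ∧
    CalibrationError.kce μ (fun ω => g (X ω)) Y k hk ≠ ⊥ ∧
    -- asymptotic normality
    0 ≤ CalibrationError.zetaOne μ X Y k hk g ∧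
    TendstoInDistribution
      (fun (n : ℕ) (ω : Ω') => √(n : ℝ) *
        (CalibrationError.skceUnbiased k g n (fun i => D i ω)
          - CalibrationError.skce μ (fun ω => g (X ω)) Y k hk))
      atTop (id : ℝ → ℝ) (fun _ => P)
      (gaussianReal 0 (4 * CalibrationError.zetaOne μ X Y k hk g).toNNReal) := by
  have hfact : Fact (Matrix.of k).PosSemidef := ⟨hk.posSemidef⟩
  let H := RKHS.OfKernel (𝕜 := ℝ) (Matrix.of k)
  have hker : RKHS.kernel H = Matrix.of k := RKHS.OfKernel.kernel_ofKernel
  have hmeas : ∀ t u, Measurable fun s => RKHS.kernel H s t u := by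
    rw [hker]; exact hk_meas
  have hG : Measurable fun ω => g (X ω) := hg.comp hX
  have hZ : Measurable fun ω => (X ω, Y ω) := hX.prodMk hY
  have hnorm : eLpNorm (fun t => √‖RKHS.kernel H t t‖) 1 (μ.map fun ω => g (X ω)) < ∞ := by
    rw [hker]; exact hk_norm
  -- `ξ` represents the mean `f ↦ 𝔼⟪e_Y - G, f(G)⟫`
  obtain ⟨ξ, hξ⟩ := RKHS.exists_inner_eq_integral (H := H) hmeas (ν := μ)
    (a := fun ω => CalibrationError.residual g (X ω, Y ω)) (τ := fun ω => g (X ω)) (C := 2)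
    ((CalibrationError.measurable_residual hg).comp hZ)
    (fun ω => CalibrationError.norm_residual_le g _) hG hnorm
  have hkce : CalibrationError.kce μ (fun ω => g (X ω)) Y k hk = (‖ξ‖ : ℝ) := by
    rw [← iSup_inner_unitBall ξ]
    have hball : CalibrationError.rkhsUnitBall k hk =
        (fun φ : H => (φ : CalibrationError.Simplex m → CalibrationError.Vec m)) ''
          {φ | ‖φ‖ ≤ 1} := rfl
    rw [CalibrationError.kce, CalibrationError.calibrationError, hball, iSup_image]
    refine iSup_congr fun φ => iSup_congr fun _ => ?_
    rw [CalibrationError.integral_inner_miscalibration hX hY hg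
      (RKHS.measurable_coe_of_measurable_kernel hmeas φ) (hξ φ).1, (hξ φ).2]
  have hskce : CalibrationError.skce μ (fun ω => g (X ω)) Y k hk = ‖ξ‖ ^ 2 := by
    rw [CalibrationError.skce, hkce, EReal.toReal_coe]
  set ν := μ.map (fun ω => (X ω, Y ω)) with hν
  have : IsProbabilityMeasure ν := Measure.isProbabilityMeasure_map hZ.aemeasurable
  let h : (𝒳 × Fin m) × (𝒳 × Fin m) → ℝ := fun p => CalibrationError.kernelTerm k g p.1 p.2
  have hsymm : ∀ z z', h (z, z') = h (z', z) := CalibrationError.kernelTerm_comm hk g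
  let h₁ : 𝒳 × Fin m → ℝ := fun z => ⟪CalibrationError.residual g z, ξ (g z.1)⟫
  have hh₁ : Measurable h₁ := (CalibrationError.measurable_residual hg).inner
    ((RKHS.measurable_coe_of_measurable_kernel hmeas ξ).comp (hg.comp measurable_fst))
  -- by the reproducing property, `ξ` also computes the projection of `h`
  have hproj : ∀ z', ∫ z, h (z, z') ∂ν = h₁ z' := by
    intro z'
    have hsec : Measurable fun z => h (z, z') := (CalibrationError.measurable_residual hg).inner
      ((hk_meas (g z'.1) (CalibrationError.residual g z')).comp (hg.comp measurable_fst))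
    have hrep := (hξ (RKHS.kerFun H (g z'.1) (CalibrationError.residual g z'))).2
    rw [RKHS.inner_kerFun, real_inner_comm] at hrep
    rw [integral_map hZ.aemeasurable hsec.aestronglyMeasurable]
    refine Eq.trans ?_ hrep.symm
    simp only [RKHS.kerFun_apply, hker]
    rfl
  have hmean : ν[h₁] = ‖ξ‖ ^ 2 := by
    rw [integral_map hZ.aemeasurable hh₁.aestronglyMeasurable, ← real_inner_self_eq_norm_sq,
      (hξ ξ).2]
  obtain ⟨hh₁mem, hsq⟩ := UStatistic.memLp_projection_and_integral_sq (h := h) hvar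
    hh₁.aestronglyMeasurable fun z => by simp only [hsymm z, hproj]
  have hzeta : CalibrationError.zetaOne μ X Y k hk g = Var[h₁; ν] := by
    rw [variance_eq_sub hh₁mem, hmean, CalibrationError.zetaOne, hskce]
    exact congrArg (· - _) hsq
  refine ⟨?_, ?_, ?_, ?_, ?_⟩
  · rintro f ⟨φ, -, rfl⟩
    exact RKHS.memLp_one_coe (H := H) hmeas hnorm φ
  · rw [hkce]; exact EReal.coe_ne_top _
  · rw [hkce]; exact EReal.coe_ne_bot _
  · rw [hzeta]; exact variance_nonneg _ _
  · have hclt := UStatistic.tendstoInDistribution (h := h) hvar hsymm hh₁mem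
      (ae_of_all _ hproj) hD_indep fun i => ⟨(hD_ident i).aemeasurable_fst, (hD_ident i).map_eq⟩
    rw [hmean, ← hskce, ← hzeta] at hclt
    exact hclt
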